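/- Let $\Delta^r=\{x\in\mathbb{R}^r : x\ge 0,\ \sum_{i=1}^r x_i\le 1\}$. For a matrix $A$, write $a_j$ for its $j$th column, let $K(A)=\max_j\|a_j\|_2$, and let $\sigma_1(A)\ge\sigma_2(A)\ge\dots$ be its singular values. Consider the following algorithm. Its input is a matrix $M'\in\mathbb{R}^{m\times n}$, an integer $r$ and a function $f:\mathbb{R}^m\to\mathbb{R}_+$. Start with $R=M'$ and no extracted index. While $R\neq 0$ and fewer than $r$ passes have been made: select an index $j^*$ maximizing $f(R_{:j})$ over all columns of $R$ (in case of a tie, an index among the tied ones for which the column $m'_j$ of the input matrix maximizes $f$; remaining ties are broken arbitrarily); put $u=R_{:j^*}$; replace $R$ by $\left(I-\frac{uu^T}{\|u\|_2^2}\right)R$; and add $j^*$ to the extracted indices. Write $J(k)$ for the $k$th extracted index. Theorem. Let $r\ge 2$ and $M'=M+N\in\mathbb{R}^{m\times n}$ with $M=W[I_r,\,H']$, where $W\in\mathbb{R}^{m\times r}$ has rank $r$ and every column of $H'\in\mathbb{R}^{r\times(n-r)}$ lies in $\Delta^r$. Let $f:\mathbb{R}^m\to\mathbb{R}_+$ be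 strongly convex with parameter $\mu>0$ (that is, $f(\delta x+(1-\delta)y)\le\delta f(x)+(1-\delta)f(y)-\frac{\mu}{2}\delta(1-\delta)\|x-y\|_2^2$ for all $x,y\in\mathbb{R}^m$ and $\delta\in[0,1]$) and differentiable with gradient Lipschitz continuous with constant $L$ with respect to $\|\cdot\|_2$, and suppose that its global minimizer is $0$, with $f(0)=0$. Suppose that $\|n_i\|_2\le\epsilon$ for every column $n_i$ of $N$, where \[ \epsilon<\sigma_r(W)\,\min\left(\frac{1}{2\sqrt{r-1}},\ \frac14\sqrt{\frac{\mu}{L}}\right)\left(1+80\,\frac{K(W)^2}{\sigma_r^2(W)}\,\frac{L}{\mu}\right)^{-1}. \] Then the algorithm applied to $M'$, $r$ and $f$ extracts $r$ distinct indices $J(1),\dots,J(r)$, and there exists a permutation $P$ of $\{1,\dots,r\}$ such that \[ \max_{1\le j\le r}\|m'_{J(j)}-w_{P(j)}\|_2\ \le\ \bar\epsilon=\epsilon\left(1+80\,\frac{K(W)^2}{\sigma_r^2(W)}\,\frac{L}{\mu}\right). \] -/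

import Mathlib

noncomputable section

namespace RecursiveNMF

/-- The unit simplex `{x ∈ ℝʳ | x ≥ 0, ∑ xᵢ ≤ 1}`. -/
def unitSimplex (r : ℕ) : Set (Fin r → ℝ) :=
  {x | (∀ i, 0 ≤ x i) ∧ ∑ i, x i ≤ 1}

/-- The `j`-th column of a real matrix, as a vector carrying the Euclidean norm. -/
def column {m : ℕ} {ι : Type*} (A : Matrix (Fin m) ι ℝ) (j : ι) : EuclideanSpace ℝ (Fin m) :=
  WithLp.toLp 2 (fun i => A i j)

/-- `K(W)`, the largest Euclidean norm of a column of `W`. -/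
def maxColNorm {m r : ℕ} (W : Matrix (Fin m) (Fin r) ℝ) : ℝ :=
  ⨆ j : Fin r, ‖column W j‖

/-- `σ_r(W)`, the `r`-th largest singular value of a matrix `W` with `r ≥ 1` columns
(Mathlib numbers singular values from `0`, in decreasing order). -/
def sigmaMin {m r : ℕ} (W : Matrix (Fin m) (Fin r) ℝ) : ℝ :=
  (Matrix.toEuclideanLin W).singularValues (r - 1)

/-- `f : ℝᵐ → ℝ₊` is strongly convex with parameter `μ > 0`, its gradient is Lipschitz continuous
with constant `L`, and its global minimizer is the origin, with `f 0 = 0`. -/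
structure IsAdmissible {m : ℕ} (f : EuclideanSpace ℝ (Fin m) → ℝ) (μ L : ℝ) : Prop where
  mu_pos : 0 < μ
  nonneg : ∀ x, 0 ≤ f x
  strongConvex : StrongConvexOn Set.univ μ f
  differentiable : Differentiable ℝ f
  gradient_lipschitz : ∀ x y, ‖gradient f x - gradient f y‖ ≤ L * ‖x - y‖
  isMin_zero : IsMinOn f Set.univ 0
  map_zero : f 0 = 0

/-- The matrix `I - u uᵀ / ‖u‖²`. -/
def projMatrix {m : ℕ} (u : EuclideanSpace ℝ (Fin m)) : Matrix (Fin m) (Fin m) ℝ :=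
  1 - (‖u‖ ^ 2)⁻¹ • Matrix.vecMulVec u.ofLp u.ofLp

/-- With input matrix `M` and current residual `R`, the index `j` may be selected: it maximizes
`f` over the columns of the residual and, among the indices tied for this maximum, it maximizes
`f` over the columns of the input matrix. -/
def IsSelected {m : ℕ} {ι : Type*} (f : EuclideanSpace ℝ (Fin m) → ℝ)
    (M R : Matrix (Fin m) ι ℝ) (j : ι) : Prop :=
  (∀ i, f (column R i) ≤ f (column R j)) ∧
    ∀ i, f (column R i) = f (column R j) → f (column M i) ≤ f (column M j)

/-- `Runs f M k R J`: started from the residual `R`, and allowed at most `k` further passes, the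
loop of the algorithm on the input matrix `M` can extract the indices `J`, listed in the order
of extraction. The loop stops when no pass is left or the residual is zero; otherwise it selects an
index `j`, replaces `R` by `(I - u uᵀ / ‖u‖²) R` with `u` the `j`-th column of `R`, and goes on. -/
inductive Runs {m : ℕ} {ι : Type*} (f : EuclideanSpace ℝ (Fin m) → ℝ)
    (M : Matrix (Fin m) ι ℝ) : ℕ → Matrix (Fin m) ι ℝ → List ι → Prop
  | full (R : Matrix (Fin m) ι ℝ) : Runs f M 0 R []
  | zero (k : ℕ) : Runs f M k 0 []
  | step {k : ℕ} {R : Matrix (Fin m) ι ℝ} {j : ι} {J : List ι} (hR : R ≠ 0)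
      (hj : IsSelected f M R j) (hJ : Runs f M k (projMatrix (column R j) * R) J) :
      Runs f M (k + 1) R (j :: J)

/-- `J` is a possible output, in order of extraction, of the recursive algorithm with input
`M`, `r` and `f`; the only freedom is the choice between ties that the tie rule leaves open. -/
def IsOutput {m : ℕ} {ι : Type*} (f : EuclideanSpace ℝ (Fin m) → ℝ)
    (M : Matrix (Fin m) ι ℝ) (r : ℕ) (J : List ι) : Prop :=
  Runs f M r M J

/-- The algorithm always has an output. -/
theorem exists_isOutput {m : ℕ} {ι : Type*} [Finite ι] (f : EuclideanSpace ℝ (Fin m) → ℝ)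
    (M : Matrix (Fin m) ι ℝ) (r : ℕ) : ∃ J, IsOutput f M r J := by
  suffices h : ∀ (k : ℕ) (R : Matrix (Fin m) ι ℝ), ∃ J, Runs f M k R J from h r M
  intro k
  induction k with
  | zero => exact fun R => ⟨[], Runs.full R⟩
  | succ k ih =>
    intro R
    by_cases hR : R = 0
    · subst hR
      exact ⟨[], Runs.zero _⟩
    have : Nonempty ι := by
      by_contra h
      rw [not_nonempty_iff] at h
      exact hR (by ext i j; exact h.elim j)
    obtain ⟨j₀, hj₀⟩ := Finite.exists_max (fun i => f (column R i))
    obtain ⟨j, hj, hmax⟩ := Set.exists_max_image {i | f (column R i) = f (column R j₀)}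
      (fun i => f (column M i)) (Set.toFinite _) ⟨j₀, rfl⟩
    have hj' : f (column R j) = f (column R j₀) := hj
    obtain ⟨J, hJ⟩ := ih (projMatrix (column R j) * R)
    exact ⟨j :: J, Runs.step hR ⟨fun i => hj' ▸ hj₀ i, fun i hi => hmax i (hi.trans hj')⟩ hJ⟩

end RecursiveNMF

end

/-!
Sandwiching `f` between multiples of the squared norm turns each pass into a geometric statement. A
residual column is `P x`, where `x` is an input column and `P` a linear contraction that kills the
columns `b i` extracted so far and moves every point only within their span (`IsResidualMap`).

Suppose each `b i` lies within `η` of the vertex `w i` it was matched with, for `i ∈ T`. Then the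
residual `P (w i)` of a matched vertex has norm at most `η`. The unmatched vertices stay well
conditioned: replacing `w i` by `b i` for `i ∈ T` changes `∑ c i • w i` by at most
`√(r - 1) η ‖c‖ ≤ σ / 2 ‖c‖`, so `‖P (∑ c i • w i)‖ ≥ σ / 2 ‖c‖` for `c` supported off `T`
(`IsResidualMap.sq_mul_sum_le`). In particular the residuals of the unmatched vertices have norm at
least `σ / 2` and mutual distances at least `√2 σ / 2`.

A residual column is, up to noise `ε`, a combination of the `P (w i)` with nonnegative
coefficients `h i` of sum at most `1`. By Jensen's inequality with the quadratic gain from strong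
convexity (`IsAdmissible.map_sum_add_le`), its value under `f` falls short of the largest value at an
unmatched vertex by an amount proportional to `μ σ ^ 2 (1 - max h)`, while the noise affects values
by about `L K ε` only. Hence the selected column has a coefficient `h i ≥ 1 - δ` with `i ∉ T` and
`δ = 40 ε K L / (σ ^ 2 μ)` (`IsAdmissible.exists_one_sub_coeff_le`), and the input column is within
`ε + 2 δ K = η` of `w i`. This keeps the invariant for the next pass
(`IsResidualMap.comp_insert`). It also shows that the selected residual is nonzero, whereas columns
already extracted have residual zero, so that the extracted indices are distinct and the loop makes
all `r` passes (`Runs.exists_matching`).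
-/

namespace RecursiveNMF

open Finset

/-! ### Admissible functions -/

section Admissible

variable {m : ℕ} {f : EuclideanSpace ℝ (Fin m) → ℝ} {μ L : ℝ}

lemma IsAdmissible.gradient_zero (hf : IsAdmissible f μ L) : gradient f 0 = 0 := by
  have h : IsLocalMin f 0 := hf.isMin_zero.isLocalMin Filter.univ_mem
  have h' : fderiv ℝ f 0 = 0 := h.fderiv_eq_zero
  rw [gradient, h', _root_.map_zero]

lemma IsAdmissible.norm_gradient_le (hf : IsAdmissible f μ L) (x : EuclideanSpace ℝ (Fin m)) :
    ‖gradient f x‖ ≤ L * ‖x‖ := by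
  simpa [hf.gradient_zero] using hf.gradient_lipschitz x 0

lemma IsAdmissible.abs_sub_le (hf : IsAdmissible f μ L) (hL : 0 ≤ L) {R : ℝ}
    {a b : EuclideanSpace ℝ (Fin m)} (ha : ‖a‖ ≤ R) (hb : ‖b‖ ≤ R) :
    |f b - f a| ≤ L * R * ‖b - a‖ := by
  refine (convex_closedBall (0 : EuclideanSpace ℝ (Fin m)) R).norm_image_sub_le_of_norm_fderiv_le
    (𝕜 := ℝ) (fun x _ => hf.differentiable x) (fun x hx => ?_) (by simpa using ha) (by simpa using hb)
  rw [← toDual_gradient, LinearIsometryEquiv.norm_map]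
  exact (hf.norm_gradient_le x).trans (mul_le_mul_of_nonneg_left (by simpa using hx) hL)

lemma IsAdmissible.map_le (hf : IsAdmissible f μ L) (hL : 0 ≤ L) (x : EuclideanSpace ℝ (Fin m)) :
    f x ≤ L * ‖x‖ ^ 2 := by
  have h := hf.abs_sub_le hL (a := 0) (b := x) (R := ‖x‖) (by simp) le_rfl
  rw [hf.map_zero, sub_zero, sub_zero] at h
  nlinarith [le_abs_self (f x)]

lemma IsAdmissible.le_map (hf : IsAdmissible f μ L) (x : EuclideanSpace ℝ (Fin m)) :
    μ / 2 * ‖x‖ ^ 2 ≤ f x := by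
  by_contra! hlt
  set c := μ / 2 * ‖x‖ ^ 2 with hc
  have h0 := hf.nonneg x
  have hcpos : 0 < c := h0.trans_lt hlt
  set t := (c - f x) / (2 * c) with ht
  have htc : t * c = (c - f x) / 2 := by rw [ht]; field_simp
  have ht0 : 0 < t := div_pos (sub_pos.2 hlt) (by positivity)
  have ht1 : t < 1 := by rw [ht, div_lt_one (by positivity)]; linarith
  have h := hf.strongConvex.2 (Set.mem_univ x) (Set.mem_univ 0) ht0.le (sub_nonneg.2 ht1.le)
    (by ring)
  simp only [smul_zero, add_zero, hf.map_zero, smul_eq_mul, sub_zero, mul_zero] at h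
  have h1 := hf.nonneg (t • x)
  have h2 : t * ((1 - t) * c) ≤ t * f x := by
    rw [← hc] at h
    linarith [mul_assoc t (1 - t) c]
  have h3 := le_of_mul_le_mul_left h2 ht0
  nlinarith

/-- Comparing the quadratic bounds `μ / 2 * ‖x‖ ^ 2 ≤ f x ≤ L * ‖x‖ ^ 2`. The factor `2` could be
removed; the constants below do not need it. -/
lemma IsAdmissible.lipschitz_pos (hf : IsAdmissible f μ L) {x : EuclideanSpace ℝ (Fin m)}
    (hx : x ≠ 0) : 0 < L ∧ μ ≤ 2 * L := by
  have hx0 := norm_pos_iff.2 hx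
  have hL : 0 ≤ L :=
    nonneg_of_mul_nonneg_left ((norm_nonneg _).trans (hf.norm_gradient_le x)) hx0
  have h : μ ≤ 2 * L := by
    have := (hf.le_map x).trans (hf.map_le hL x)
    have := le_of_mul_le_mul_right this (by positivity)
    linarith
  exact ⟨by linarith [hf.mu_pos], h⟩

lemma sum_mul_sum_mul_norm_sub_sq {ι E : Type*} [Fintype ι] [NormedAddCommGroup E]
    [InnerProductSpace ℝ E] (h : ι → ℝ) (y : ι → E) :
    ∑ i, ∑ j, h i * h j * ‖y i - y j‖ ^ 2
      = 2 * ((∑ i, h i) * ∑ i, h i * ‖y i‖ ^ 2 - ‖∑ i, h i • y i‖ ^ 2) := by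
  have e1 : ‖∑ i, h i • y i‖ ^ 2 = ∑ i, ∑ j, h i * h j * inner ℝ (y i) (y j) := by
    rw [← real_inner_self_eq_norm_sq, sum_inner]
    simp only [inner_sum, real_inner_smul_left, real_inner_smul_right]
    exact sum_congr rfl fun i _ => sum_congr rfl fun j _ => by ring
  have e2 : (∑ i, h i) * ∑ i, h i * ‖y i‖ ^ 2 = ∑ i, ∑ j, h i * (h j * ‖y j‖ ^ 2) :=
    Finset.sum_mul_sum _ _ _ _
  have e3 : (∑ i, h i) * ∑ i, h i * ‖y i‖ ^ 2 = ∑ i, ∑ j, h i * (h j * ‖y i‖ ^ 2) := by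
    rw [mul_comm, Finset.sum_mul_sum]
    exact sum_congr rfl fun i _ => sum_congr rfl fun j _ => by ring
  have e4 : ∑ i, ∑ j, h i * h j * ‖y i - y j‖ ^ 2 =
      ∑ i, ∑ j, h i * (h j * ‖y i‖ ^ 2) + ∑ i, ∑ j, h i * (h j * ‖y j‖ ^ 2)
        - 2 * ∑ i, ∑ j, h i * h j * inner ℝ (y i) (y j) := by
    simp only [mul_sum, ← sum_add_distrib, ← sum_sub_distrib]
    refine sum_congr rfl fun i _ => sum_congr rfl fun j _ => ?_
    rw [norm_sub_sq_real]
    ring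
  rw [e4, ← e2, ← e3, ← e1]
  ring

/-- Jensen's inequality for weights of total mass at most `1`, the missing mass being put at the
minimizer `0`, with the gain that strong convexity gives in terms of pairwise distances. -/
lemma IsAdmissible.map_sum_add_le (hf : IsAdmissible f μ L) {ι : Type*} [Fintype ι]
    {h : ι → ℝ} (h0 : ∀ i, 0 ≤ h i) (h1 : ∑ i, h i ≤ 1) (y : ι → EuclideanSpace ℝ (Fin m)) :
    f (∑ i, h i • y i) + μ / 4 * ∑ i, ∑ j, h i * h j * ‖y i - y j‖ ^ 2 ≤ ∑ i, h i * f (y i) := by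
  have hJ := (strongConvexOn_iff_convex.1 hf.strongConvex).map_add_sum_le (t := univ)
    (w := h) (p := y) (v := 1 - ∑ i, h i) (q := 0) (fun i _ => h0 i) (by ring)
    (fun i _ => Set.mem_univ _) (by linarith) (Set.mem_univ _)
  simp only [smul_zero, zero_add, hf.map_zero, norm_zero, smul_eq_mul, mul_sub,
    sum_sub_distrib] at hJ
  have e : ∑ i, h i * (μ / 2 * ‖y i‖ ^ 2) = μ / 2 * ∑ i, h i * ‖y i‖ ^ 2 := by
    rw [mul_sum]; exact sum_congr rfl fun i _ => by ring
  rw [e] at hJ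
  have hs : (∑ i, h i) * ∑ i, h i * ‖y i‖ ^ 2 ≤ ∑ i, h i * ‖y i‖ ^ 2 :=
    mul_le_of_le_one_left (sum_nonneg fun i _ => mul_nonneg (h0 i) (sq_nonneg _)) h1
  rw [sum_mul_sum_mul_norm_sub_sq]
  nlinarith [hf.mu_pos]

/-! ### One selection -/

/-- The arithmetic behind one selection: `h` is the largest coefficient on the unmatched
vertices, `s` the mass of these, and `a` the rest. The loss `a / 4 + s * (s - h) / 2` in the value of
`f` is more than the noise can make up for unless `h` is close to `1`. -/
lemma one_sub_le_of_gain_le {a s h δ : ℝ} (hs : s = 1 - a) (ha : 0 ≤ a) (hh : h ≤ s) (hs0 : 0 ≤ s)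
    (hδ : δ ≤ 1 / 5)
    (hgain : a / 4 + s * (s - h) / 2 ≤ 101 / 500 * δ) : 1 - h ≤ δ := by
  subst hs
  by_contra! hlt
  have hδ0 : 0 ≤ δ := by nlinarith [mul_nonneg hs0 (sub_nonneg.2 hh)]
  have ha' : a ≤ 101 / 125 * δ := by nlinarith [mul_nonneg hs0 (sub_nonneg.2 hh)]
  have h2 : (1 - a) * (δ - a) < (1 - a) * (1 - a - h) :=
    mul_lt_mul_of_pos_left (by linarith) (by linarith)
  nlinarith [mul_nonneg ha hδ0, mul_nonneg hδ0 (sub_nonneg.2 hδ), mul_nonneg hδ0 (sub_nonneg.2 ha')]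

/-- Among the points `y i`, those with `i ∈ S` are long and far apart and the others are short. A
subconvex combination whose perturbation by `e` has at least the value of `f` at each perturbed
`y i`, `i ∈ S`, puts almost all its mass on a single index of `S`. -/
lemma IsAdmissible.exists_one_sub_coeff_le (hf : IsAdmissible f μ L) (hL : 0 < L)
    {ι : Type*} [Fintype ι] [DecidableEq ι] {y : ι → EuclideanSpace ℝ (Fin m)} {S : Finset ι}
    (hS : S.Nonempty) {K ω η ε δ : ℝ} (hK : ∀ i, ‖y i‖ ≤ K)
    (hω : 0 < ω) (hyS : ∀ i ∈ S, ω ≤ ‖y i‖)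
    (hdist : ∀ i ∈ S, ∀ j ∈ S, i ≠ j → 2 * ω ^ 2 ≤ ‖y i - y j‖ ^ 2)
    (hη : ∀ i ∉ S, ‖y i‖ ≤ η) (hηω : 4 * (L * η ^ 2) ≤ μ * ω ^ 2)
    (hεK : 100 * ε ≤ K) (hδ : 10 * (ε * K * L) = δ * (μ * ω ^ 2)) (hδ5 : δ ≤ 1 / 5)
    {h : ι → ℝ} (h0 : ∀ i, 0 ≤ h i) (h1 : ∑ i, h i ≤ 1)
    {e : EuclideanSpace ℝ (Fin m)} (he : ‖e‖ ≤ ε) {e' : ι → EuclideanSpace ℝ (Fin m)}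
    (he' : ∀ i, ‖e' i‖ ≤ ε) (hmax : ∀ i ∈ S, f (y i + e' i) ≤ f (∑ i, h i • y i + e)) :
    ∃ i ∈ S, 1 - h i ≤ δ := by
  have hμ := hf.mu_pos
  have hε0 : 0 ≤ ε := (norm_nonneg _).trans he
  obtain ⟨p, hpS, hp⟩ := S.exists_max_image (fun i => f (y i)) hS
  obtain ⟨k, hkS, hk⟩ := S.exists_max_image h hS
  refine ⟨k, hkS, ?_⟩
  -- `F` is the largest value at an unmatched vertex, `s` the mass on these, `a` the rest.
  set F := f (y p) with hF
  set s := ∑ i ∈ S, h i with hs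
  set a := 1 - s with ha
  have hK0 : 0 ≤ K := (norm_nonneg _).trans (hK p)
  have hsplit : ∀ g : ι → ℝ, ∑ i, g i = ∑ i ∈ S, g i + ∑ i ∈ Sᶜ, g i :=
    fun g => (sum_add_sum_compl S g).symm
  have hs0 : 0 ≤ s := sum_nonneg fun i _ => h0 i
  have hc0 : 0 ≤ ∑ i ∈ Sᶜ, h i := sum_nonneg fun i _ => h0 i
  have hca : ∑ i ∈ Sᶜ, h i ≤ a := by
    have := hsplit h
    rw [ha]; linarith
  have hks : h k ≤ s := single_le_sum (fun i _ => h0 i) hkS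
  have hFlow : μ / 2 * ω ^ 2 ≤ F := by
    refine le_trans ?_ (hf.le_map (y p))
    have : ω ^ 2 ≤ ‖y p‖ ^ 2 := pow_le_pow_left₀ hω.le (hyS p hpS) 2
    nlinarith
  have hF0 : 0 ≤ F := hf.nonneg _
  have hsmall : ∀ i ∉ S, f (y i) ≤ F / 2 := by
    intro i hi
    have h2 : ‖y i‖ ^ 2 ≤ η ^ 2 := pow_le_pow_left₀ (norm_nonneg _) (hη i hi) 2
    have h3 := hf.map_le hL.le (y i)
    nlinarith
  have hval : ∑ i, h i * f (y i) ≤ F - a * (F / 2) := by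
    rw [hsplit]
    have h2 : ∑ i ∈ S, h i * f (y i) ≤ s * F := by
      rw [hs, sum_mul]
      exact sum_le_sum fun i hi => mul_le_mul_of_nonneg_left (hp i hi) (h0 i)
    have h3 : ∑ i ∈ Sᶜ, h i * f (y i) ≤ (∑ i ∈ Sᶜ, h i) * (F / 2) := by
      rw [sum_mul]
      exact sum_le_sum fun i hi =>
        mul_le_mul_of_nonneg_left (hsmall i (by simpa using hi)) (h0 i)
    have h4 : (∑ i ∈ Sᶜ, h i) * (F / 2) ≤ a * (F / 2) :=
      mul_le_mul_of_nonneg_right hca (by linarith)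
    have : s = 1 - a := by rw [ha]; ring
    rw [this] at h2
    linarith
  -- The pairs of distinct indices of `S` alone already give the required spread.
  have hpairs : 2 * ω ^ 2 * (s * (s - h k))
      ≤ ∑ i, ∑ j, h i * h j * ‖y i - y j‖ ^ 2 := by
    calc 2 * ω ^ 2 * (s * (s - h k))
        = 2 * ω ^ 2 * ∑ i ∈ S, h i * (s - h k) := by rw [← sum_mul]
      _ ≤ 2 * ω ^ 2 * ∑ i ∈ S, h i * (s - h i) := by
          refine mul_le_mul_of_nonneg_left (sum_le_sum fun i hi => ?_) (by positivity)
          exact mul_le_mul_of_nonneg_left (by linarith [hk i hi]) (h0 i)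
      _ = ∑ i ∈ S, ∑ j ∈ S.erase i, h i * h j * (2 * ω ^ 2) := by
          rw [mul_sum]
          refine sum_congr rfl fun i hi => ?_
          rw [← sum_mul, ← mul_sum, hs, ← add_sum_erase S h hi]
          ring
      _ ≤ ∑ i ∈ S, ∑ j ∈ S.erase i, h i * h j * ‖y i - y j‖ ^ 2 := by
          refine sum_le_sum fun i hi => sum_le_sum fun j hj => ?_
          exact mul_le_mul_of_nonneg_left
            (hdist i hi j (mem_of_mem_erase hj) (ne_of_mem_erase hj).symm)
            (mul_nonneg (h0 i) (h0 j))
      _ ≤ ∑ i, ∑ j, h i * h j * ‖y i - y j‖ ^ 2 := by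
          have hnn : ∀ i j, 0 ≤ h i * h j * ‖y i - y j‖ ^ 2 := fun i j =>
            mul_nonneg (mul_nonneg (h0 i) (h0 j)) (sq_nonneg _)
          refine (sum_le_sum fun i _ => sum_le_univ_sum_of_nonneg (hnn i)).trans
            (sum_le_univ_sum_of_nonneg fun i => sum_nonneg fun j _ => hnn i j)
  have hJ := hf.map_sum_add_le h0 h1 y
  have hyn : ‖∑ i, h i • y i‖ ≤ K := by
    calc ‖∑ i, h i • y i‖ ≤ ∑ i, h i * K := norm_sum_le_of_le _ fun i _ => by
          rw [norm_smul, Real.norm_of_nonneg (h0 i)]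
          exact mul_le_mul_of_nonneg_left (hK i) (h0 i)
      _ ≤ K := by
          rw [← sum_mul]
          exact mul_le_of_le_one_left hK0 h1
  -- Perturbing a point of norm at most `K` by at most `ε` changes `f` by at most `L (K + ε) ε`.
  have hpert : ∀ z n : EuclideanSpace ℝ (Fin m), ‖z‖ ≤ K → ‖n‖ ≤ ε →
      |f (z + n) - f z| ≤ L * (K + ε) * ε := by
    intro z n hz hn
    have := hf.abs_sub_le hL.le (a := z) (b := z + n) (R := K + ε) (by linarith)
      ((norm_add_le _ _).trans (add_le_add hz hn))
    rw [add_sub_cancel_left] at this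
    exact this.trans (mul_le_mul_of_nonneg_left hn (by positivity))
  have hp1 := abs_le.1 (hpert _ _ hyn he)
  have hp2 := abs_le.1 (hpert _ _ (hK p) (he' p))
  have hp3 := hmax p hpS
  have hLe : L * (K + ε) * ε ≤ 101 / 100 * (ε * K * L) := by
    have : L * ε * (100 * ε) ≤ L * ε * K := mul_le_mul_of_nonneg_left hεK (by positivity)
    nlinarith
  have ha0 : 0 ≤ a := hc0.trans hca
  have hgain : (a / 4 + s * (s - h k) / 2) * (μ * ω ^ 2) ≤ 101 / 500 * δ * (μ * ω ^ 2) := by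
    have g1 : μ / 4 * (2 * ω ^ 2 * (s * (s - h k)))
        ≤ μ / 4 * ∑ i, ∑ j, h i * h j * ‖y i - y j‖ ^ 2 :=
      mul_le_mul_of_nonneg_left hpairs (by linarith)
    have g2 : a * (μ / 2 * ω ^ 2) ≤ a * F := mul_le_mul_of_nonneg_left hFlow ha0
    linarith
  exact one_sub_le_of_gain_le (by rw [ha]; ring) ha0 hks hs0 hδ5
    (le_of_mul_le_mul_right hgain (by positivity))

end Admissible

/-! ### Smallest singular value -/

lemma singularValues_pred_mul_norm_le {E F : Type*} [NormedAddCommGroup E] [InnerProductSpace ℝ E]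
    [FiniteDimensional ℝ E] [NormedAddCommGroup F] [InnerProductSpace ℝ F]
    [FiniteDimensional ℝ F] (T : E →ₗ[ℝ] F) {n : ℕ} (hn : Module.finrank ℝ E = n) (x : E) :
    T.singularValues (n - 1) * ‖x‖ ≤ ‖T x‖ := by
  rcases Nat.eq_zero_or_pos n with rfl | hpos
  · have : Subsingleton E := Module.finrank_zero_iff.1 hn
    simp [Subsingleton.elim x 0]
  have hT := T.isSymmetric_adjoint_comp_self
  set v := (hT.eigenvectorBasis hn).repr x with hv
  have h1 : ‖T x‖ ^ 2 = ∑ i, hT.eigenvalues hn i * v i ^ 2 := by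
    rw [← real_inner_self_eq_norm_sq, ← LinearMap.adjoint_inner_left,
      ← (hT.eigenvectorBasis hn).repr.inner_map_map, PiLp.inner_apply]
    refine sum_congr rfl fun i _ => ?_
    rw [← LinearMap.comp_apply, hT.eigenvectorBasis_apply_self_apply hn]
    simp [hv]
    ring
  have h2 : ‖x‖ ^ 2 = ∑ i, v i ^ 2 := by
    rw [← (hT.eigenvectorBasis hn).repr.norm_map, EuclideanSpace.real_norm_sq_eq]
  refine (sq_le_sq₀ (mul_nonneg (T.singularValues_nonneg _) (norm_nonneg _)) (norm_nonneg _)).1 ?_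
  rw [mul_pow, T.sq_singularValues_of_lt hn (Nat.sub_lt hpos one_pos), h1, h2, mul_sum]
  refine sum_le_sum fun i _ => mul_le_mul_of_nonneg_right ?_ (sq_nonneg _)
  exact hT.eigenvalues_antitone hn (Fin.le_def.2 (Nat.le_sub_one_of_lt i.2))

lemma sq_sigmaMin_mul_le {m r : ℕ} (W : Matrix (Fin m) (Fin r) ℝ) (c : Fin r → ℝ) :
    sigmaMin W ^ 2 * ∑ i, c i ^ 2 ≤ ‖∑ i, c i • column W i‖ ^ 2 := by
  have h := singularValues_pred_mul_norm_le (Matrix.toEuclideanLin W) (n := r)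
    (by simp) (WithLp.toLp 2 c)
  have e : Matrix.toEuclideanLin W (WithLp.toLp 2 c) = ∑ i, c i • column W i := by
    ext k
    simp [column, Matrix.mulVec, dotProduct, mul_comm]
  rw [e] at h
  have h2 := pow_le_pow_left₀
    (mul_nonneg (LinearMap.singularValues_nonneg _ _) (norm_nonneg _)) h 2
  rwa [mul_pow, EuclideanSpace.real_norm_sq_eq] at h2

lemma norm_column_le_maxColNorm {m r : ℕ} (W : Matrix (Fin m) (Fin r) ℝ) (i : Fin r) :
    ‖column W i‖ ≤ maxColNorm W :=
  le_ciSup (f := fun j => ‖column W j‖) (Set.finite_range _).bddAbove i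

/-! ### Residual maps -/

section Residual

variable {ι E : Type*} [NormedAddCommGroup E] [InnerProductSpace ℝ E]

/-- The linear map `P` takes the input columns to the residual columns after the vectors `b i`,
`i ∈ T`, have been extracted, where `b i` is within `η` of `w i`. Of the orthogonal projection
along the span of these vectors, only the properties listed here are needed. -/
structure IsResidualMap (w : ι → E) (η : ℝ) (T : Finset ι) (b : ι → E) (P : E →ₗ[ℝ] E) :
    Prop where
  norm_map_le : ∀ x, ‖P x‖ ≤ ‖x‖
  norm_sub_le : ∀ i ∈ T, ‖b i - w i‖ ≤ η
  map_eq_zero : ∀ i ∈ T, P (b i) = 0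
  sub_map_mem : ∀ x, x - P x ∈ Submodule.span ℝ (b '' T)

lemma isResidualMap_id (w b : ι → E) (η : ℝ) : IsResidualMap w η ∅ b LinearMap.id where
  norm_map_le _ := le_rfl
  norm_sub_le := by simp
  map_eq_zero := by simp
  sub_map_mem := by simp

lemma IsResidualMap.norm_map_le_of_mem {w : ι → E} {η : ℝ} {T : Finset ι} {b : ι → E}
    {P : E →ₗ[ℝ] E} (h : IsResidualMap w η T b P) {i : ι} (hi : i ∈ T) : ‖P (w i)‖ ≤ η := by
  have e : P (w i) = -P (b i - w i) := by rw [map_sub, h.map_eq_zero i hi]; simp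
  rw [e, norm_neg]
  exact (h.norm_map_le _).trans (h.norm_sub_le i hi)

/-- Replacing `w i` by `b i` for `i ∈ T` at most halves the smallest singular value, and the
residual map is a quotient map up to the span of the `b i`; so it keeps the other `w i` well
conditioned. -/
lemma IsResidualMap.sq_mul_sum_le [Fintype ι] [DecidableEq ι] {w : ι → E} {η : ℝ} {T : Finset ι}
    {b : ι → E} {P : E →ₗ[ℝ] E} (h : IsResidualMap w η T b P) {σ : ℝ} (hσ : 0 ≤ σ)
    (hw : ∀ c : ι → ℝ, σ ^ 2 * ∑ i, c i ^ 2 ≤ ‖∑ i, c i • w i‖ ^ 2)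
    (hT : #T * η ^ 2 ≤ (σ / 2) ^ 2) (c : ι → ℝ) (hc : ∀ i ∈ T, c i = 0) :
    (σ / 2) ^ 2 * ∑ i, c i ^ 2 ≤ ‖P (∑ i, c i • w i)‖ ^ 2 := by
  obtain ⟨d, hd⟩ := (Submodule.mem_span_image_finset_iff_exists_fun' ℝ).1
    (h.sub_map_mem (∑ i, c i • w i))
  set g : ι → ℝ := fun i => if i ∈ T then -d i else c i with hg
  have hsq : ∑ i, g i ^ 2 = ∑ i, c i ^ 2 + ∑ i ∈ T, d i ^ 2 := by
    rw [← sum_add_sum_compl T fun i => g i ^ 2, ← sum_add_sum_compl T fun i => c i ^ 2]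
    have e1 : ∑ i ∈ T, g i ^ 2 = ∑ i ∈ T, d i ^ 2 :=
      sum_congr rfl fun i hi => by simp [hg, hi]
    have e2 : ∑ i ∈ Tᶜ, g i ^ 2 = ∑ i ∈ Tᶜ, c i ^ 2 :=
      sum_congr rfl fun i hi => by simp [hg, mem_compl.1 hi]
    have e3 : ∑ i ∈ T, c i ^ 2 = 0 := sum_eq_zero fun i hi => by simp [hc i hi]
    rw [e1, e2, e3]; ring
  have hdec : P (∑ i, c i • w i) = ∑ i, g i • w i - ∑ i ∈ T, d i • (b i - w i) := by
    have e0 : P (∑ i, c i • w i) = ∑ i, c i • w i - ∑ i ∈ T, d i • b i := by rw [hd]; abel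
    have e1 : ∑ i, g i • w i = ∑ i, c i • w i - ∑ i ∈ T, d i • w i := by
      rw [← sum_add_sum_compl T fun i => g i • w i, ← sum_add_sum_compl T fun i => c i • w i]
      have e1 : ∑ i ∈ T, g i • w i = -∑ i ∈ T, d i • w i := by
        rw [← sum_neg_distrib]
        exact sum_congr rfl fun i hi => by simp [hg, hi]
      have e2 : ∑ i ∈ Tᶜ, g i • w i = ∑ i ∈ Tᶜ, c i • w i :=
        sum_congr rfl fun i hi => by simp [hg, mem_compl.1 hi]
      have e3 : ∑ i ∈ T, c i • w i = 0 := sum_eq_zero fun i hi => by simp [hc i hi]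
      rw [e1, e2, e3]; abel
    rw [e0, e1]
    simp only [smul_sub, sum_sub_distrib]
    abel
  -- `P` sends `∑ c i • w i` to a combination of all the `w i` with coefficient norm `A`, up to an
  -- error that costs at most half of the bound `σ * A`.
  set A := √(∑ i, g i ^ 2) with hA
  have hA0 : 0 ≤ A := Real.sqrt_nonneg _
  have hA2 : A ^ 2 = ∑ i, g i ^ 2 := Real.sq_sqrt (sum_nonneg fun i _ => sq_nonneg _)
  have h1 : σ * A ≤ ‖∑ i, g i • w i‖ := by
    refine le_of_sq_le_sq ?_ (norm_nonneg _)
    rw [mul_pow, hA2]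
    exact hw g
  have h2 : ‖∑ i ∈ T, d i • (b i - w i)‖ ≤ σ / 2 * A := by
    have h3 : ‖∑ i ∈ T, d i • (b i - w i)‖ ≤ (∑ i ∈ T, |d i|) * η := by
      rw [sum_mul]
      refine norm_sum_le_of_le _ fun i hi => ?_
      rw [norm_smul, Real.norm_eq_abs]
      exact mul_le_mul_of_nonneg_left (h.norm_sub_le i hi) (abs_nonneg _)
    refine h3.trans (le_of_sq_le_sq ?_ (by positivity))
    have h4 : (∑ i ∈ T, |d i|) ^ 2 ≤ #T * ∑ i ∈ T, d i ^ 2 := by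
      simpa using sq_sum_le_card_mul_sum_sq (s := T) (f := fun i => |d i|)
    have h5 : ∑ i ∈ T, d i ^ 2 ≤ A ^ 2 := by
      rw [hA2, hsq]
      linarith [sum_nonneg fun i (_ : i ∈ univ) => sq_nonneg (c i)]
    calc ((∑ i ∈ T, |d i|) * η) ^ 2 = (∑ i ∈ T, |d i|) ^ 2 * η ^ 2 := mul_pow _ _ _
      _ ≤ (#T * ∑ i ∈ T, d i ^ 2) * η ^ 2 := mul_le_mul_of_nonneg_right h4 (sq_nonneg _)
      _ = (#T * η ^ 2) * ∑ i ∈ T, d i ^ 2 := by ring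
      _ ≤ (σ / 2) ^ 2 * A ^ 2 :=
          mul_le_mul hT h5 (sum_nonneg fun i _ => sq_nonneg _) (sq_nonneg _)
      _ = (σ / 2 * A) ^ 2 := (mul_pow _ _ _).symm
  have h6 : σ / 2 * A ≤ ‖P (∑ i, c i • w i)‖ := by
    rw [hdec]
    have := norm_sub_norm_le (∑ i, g i • w i) (∑ i ∈ T, d i • (b i - w i))
    linarith
  calc (σ / 2) ^ 2 * ∑ i, c i ^ 2 ≤ (σ / 2) ^ 2 * A ^ 2 := by
        refine mul_le_mul_of_nonneg_left ?_ (sq_nonneg _)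
        rw [hA2, hsq]
        linarith [sum_nonneg fun i (_ : i ∈ T) => sq_nonneg (d i)]
    _ = (σ / 2 * A) ^ 2 := (mul_pow _ _ _).symm
    _ ≤ _ := pow_le_pow_left₀ (by positivity) h6 2

/-- Extracting one more vector `x`, close to `w i`, composes the residual map with a
contraction `Q` that kills the residual `P x` and moves points only along it. -/
lemma IsResidualMap.comp_insert [DecidableEq ι] {w : ι → E} {η : ℝ} {T : Finset ι}
    {b : ι → E} {P : E →ₗ[ℝ] E} (h : IsResidualMap w η T b P) {i : ι} (hi : i ∉ T) {x : E}
    (hx : ‖x - w i‖ ≤ η) {Q : E →ₗ[ℝ] E} (hQ : ∀ z, ‖Q z‖ ≤ ‖z‖) (hQx : Q (P x) = 0)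
    (hQs : ∀ z, ∃ t : ℝ, z - Q z = t • P x) :
    IsResidualMap w η (insert i T) (Function.update b i x) (Q ∘ₗ P) := by
  have hne : ∀ j ∈ T, j ≠ i := fun j hj => ne_of_mem_of_not_mem hj hi
  refine ⟨fun z => (hQ _).trans (h.norm_map_le z), fun j hj => ?_, fun j hj => ?_, fun z => ?_⟩
  · rcases mem_insert.1 hj with rfl | hj
    · simpa using hx
    · rw [Function.update_of_ne (hne j hj)]
      exact h.norm_sub_le j hj
  · rcases mem_insert.1 hj with rfl | hj
    · simpa using hQx
    · rw [Function.update_of_ne (hne j hj), LinearMap.comp_apply, h.map_eq_zero j hj, map_zero]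
  · have hsub : b '' T ⊆ Function.update b i x '' (insert i T : Finset ι) := by
      rintro _ ⟨j, hj, rfl⟩
      exact ⟨j, by simp [mem_coe.1 hj], Function.update_of_ne (hne j hj) _ _⟩
    have hle := Submodule.span_mono (R := ℝ) hsub
    have hxm : x ∈ Submodule.span ℝ (Function.update b i x '' (insert i T : Finset ι)) :=
      Submodule.subset_span ⟨i, by simp, by simp⟩
    have hPx : P x ∈ Submodule.span ℝ (Function.update b i x '' (insert i T : Finset ι)) := by
      have := Submodule.sub_mem _ hxm (hle (h.sub_map_mem x))
      rwa [sub_sub_cancel] at this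
    obtain ⟨t, ht⟩ := hQs (P z)
    have e : z - (Q ∘ₗ P) z = (z - P z) + t • P x := by
      rw [← ht, LinearMap.comp_apply]; abel
    rw [e]
    exact Submodule.add_mem _ (hle (h.sub_map_mem z)) (Submodule.smul_mem _ _ hPx)

end Residual

lemma toEuclideanLin_projMatrix_apply {m : ℕ} (u x : EuclideanSpace ℝ (Fin m)) :
    (projMatrix u).toEuclideanLin x = x - ((‖u‖ ^ 2)⁻¹ * inner ℝ u x) • u := by
  ext k
  simp [projMatrix, Matrix.vecMulVec_mulVec, PiLp.inner_apply, dotProduct, mul_comm]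
  ring

lemma column_mul {m : ℕ} {ι : Type*} (A : Matrix (Fin m) (Fin m) ℝ) (R : Matrix (Fin m) ι ℝ)
    (j : ι) : column (A * R) j = A.toEuclideanLin (column R j) := by
  ext k
  simp [column, Matrix.mul_apply, Matrix.mulVec, dotProduct]

lemma toEuclideanLin_projMatrix_self {m : ℕ} (u : EuclideanSpace ℝ (Fin m)) :
    (projMatrix u).toEuclideanLin u = 0 := by
  rw [toEuclideanLin_projMatrix_apply, real_inner_self_eq_norm_sq]
  by_cases hu : u = 0
  · simp [hu]
  · rw [inv_mul_cancel₀ (by simpa using hu), one_smul, sub_self]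

lemma norm_toEuclideanLin_projMatrix_le {m : ℕ} (u x : EuclideanSpace ℝ (Fin m)) :
    ‖(projMatrix u).toEuclideanLin x‖ ≤ ‖x‖ := by
  refine le_of_sq_le_sq ?_ (norm_nonneg _)
  rw [toEuclideanLin_projMatrix_apply, norm_sub_sq_real, real_inner_smul_right, norm_smul,
    mul_pow, Real.norm_eq_abs, sq_abs, real_inner_comm u x]
  by_cases hu : u = 0
  · simp [hu]
  · have hu2 : 0 < ‖u‖ ^ 2 := by positivity
    have : ((‖u‖ ^ 2)⁻¹ * inner ℝ u x) ^ 2 * ‖u‖ ^ 2 = (‖u‖ ^ 2)⁻¹ * inner ℝ u x * inner ℝ u x := by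
      field_simp
    have h0 : 0 ≤ (‖u‖ ^ 2)⁻¹ * inner ℝ u x * inner ℝ u x := by
      rw [mul_assoc]
      exact mul_nonneg (by positivity) (mul_self_nonneg _)
    rw [this]
    linarith

/-! ### Extraction of the vertices -/

/-- The points `X j` are, up to errors of norm at most `ε`, subconvex combinations of the `w i`,
with coefficients `h j i`, and every `w i` is itself approximated by one of them. -/
structure IsNearSeparable {ι κ E : Type*} [Fintype ι] [NormedAddCommGroup E] [Module ℝ E]
    (X : κ → E) (w : ι → E) (h : κ → ι → ℝ) (ε : ℝ) : Prop where
  coeff_nonneg : ∀ j i, 0 ≤ h j i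
  sum_coeff_le : ∀ j, ∑ i, h j i ≤ 1
  norm_sub_le : ∀ j, ‖X j - ∑ i, h j i • w i‖ ≤ ε
  exists_near : ∀ i, ∃ j, ‖X j - w i‖ ≤ ε

/-- The requirements on the constants: `σ` bounds the smallest singular value from below, `K` the
norms of the vertices, `ε` the noise, `η` the distance of an extracted column to its vertex, and `δ`
the mass that an extracted column may have off its vertex. -/
structure IsNoiseBound (r : ℕ) (μ L σ K ε η δ : ℝ) : Prop where
  σ_pos : 0 < σ
  L_pos : 0 < L
  lt_half : ε < σ / 2
  mul_le_K : 100 * ε ≤ K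
  L_mul_le : 4 * (L * η ^ 2) ≤ μ * (σ / 2) ^ 2
  card_mul_le : ((r : ℝ) - 1) * η ^ 2 ≤ (σ / 2) ^ 2
  mul_eq : 10 * (ε * K * L) = δ * (μ * (σ / 2) ^ 2)
  δ_le : δ ≤ 1 / 5
  add_le : ε + 2 * δ * K ≤ η

lemma norm_sum_smul_sub_le {ι E : Type*} [Fintype ι] [DecidableEq ι] [NormedAddCommGroup E]
    [NormedSpace ℝ E] {h : ι → ℝ} (h0 : ∀ i, 0 ≤ h i) (h1 : ∑ i, h i ≤ 1) {w : ι → E} {K : ℝ}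
    (hK : ∀ i, ‖w i‖ ≤ K) (i : ι) : ‖∑ j, h j • w j - w i‖ ≤ 2 * (1 - h i) * K := by
  have hK0 : 0 ≤ K := (norm_nonneg _).trans (hK i)
  have hsum := add_sum_erase univ h (mem_univ i)
  have hrest : 0 ≤ ∑ j ∈ univ.erase i, h j := sum_nonneg fun j _ => h0 j
  have e : ∑ j, h j • w j - w i = ∑ j ∈ univ.erase i, h j • w j - (1 - h i) • w i := by
    rw [← add_sum_erase univ (fun j => h j • w j) (mem_univ i), sub_smul, one_smul]
    abel
  have n1 : ‖∑ j ∈ univ.erase i, h j • w j‖ ≤ (∑ j ∈ univ.erase i, h j) * K := by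
    rw [sum_mul]
    refine norm_sum_le_of_le _ fun j _ => ?_
    rw [norm_smul, Real.norm_of_nonneg (h0 j)]
    exact mul_le_mul_of_nonneg_left (hK j) (h0 j)
  have n2 : ‖(1 - h i) • w i‖ ≤ (1 - h i) * K := by
    rw [norm_smul, Real.norm_of_nonneg (by linarith)]
    exact mul_le_mul_of_nonneg_left (hK i) (by linarith)
  have n3 : (∑ j ∈ univ.erase i, h j) * K ≤ (1 - h i) * K :=
    mul_le_mul_of_nonneg_right (by linarith) hK0
  rw [e]
  linarith [norm_sub_le (∑ j ∈ univ.erase i, h j • w j) ((1 - h i) • w i)]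

variable {m r : ℕ} {κ : Type*} {f : EuclideanSpace ℝ (Fin m) → ℝ} {μ L σ K ε η δ : ℝ}
  {w : Fin r → EuclideanSpace ℝ (Fin m)} {h : κ → Fin r → ℝ} {X : κ → EuclideanSpace ℝ (Fin m)}

/-- As long as some vertex is unmatched, a column whose residual maximizes `f` is close to an
unmatched vertex and has a nonzero residual. -/
lemma IsResidualMap.exists_near_of_isMax (hf : IsAdmissible f μ L)
    (hc : IsNoiseBound r μ L σ K ε η δ) (hX : IsNearSeparable X w h ε)
    (hK : ∀ i, ‖w i‖ ≤ K) (hw : ∀ c : Fin r → ℝ, σ ^ 2 * ∑ i, c i ^ 2 ≤ ‖∑ i, c i • w i‖ ^ 2)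
    {T : Finset (Fin r)} (hT : #T < r) {b : Fin r → EuclideanSpace ℝ (Fin m)}
    {P : EuclideanSpace ℝ (Fin m) →ₗ[ℝ] EuclideanSpace ℝ (Fin m)}
    (hP : IsResidualMap w η T b P) {j : κ} (hj : ∀ k, f (P (X k)) ≤ f (P (X j))) :
    P (X j) ≠ 0 ∧ ∃ i ∉ T, ‖X j - w i‖ ≤ η := by
  have hσ := hc.σ_pos
  have hTη : #T * η ^ 2 ≤ (σ / 2) ^ 2 := by
    refine le_trans (mul_le_mul_of_nonneg_right ?_ (sq_nonneg _)) hc.card_mul_le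
    have : ((#T + 1 : ℕ) : ℝ) ≤ r := Nat.cast_le.2 hT
    push_cast at this
    linarith
  have hlow := hP.sq_mul_sum_le hσ.le hw hTη
  have hnorm : ∀ i ∈ Tᶜ, σ / 2 ≤ ‖P (w i)‖ := by
    intro i hi
    have := hlow (Pi.single i 1) fun k hk => Pi.single_eq_of_ne
      (ne_of_mem_of_not_mem hk (mem_compl.1 hi)) _
    simp only [Pi.single_apply, ite_pow, one_pow, ne_eq, OfNat.ofNat_ne_zero, not_false_eq_true,
      zero_pow, sum_ite_eq', mem_univ, if_true, mul_one, ite_smul, one_smul, zero_smul] at this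
    exact le_of_sq_le_sq this (norm_nonneg _)
  have hdist : ∀ i ∈ Tᶜ, ∀ k ∈ Tᶜ, i ≠ k → 2 * (σ / 2) ^ 2 ≤ ‖P (w i) - P (w k)‖ ^ 2 := by
    intro i hi k hk hik
    have := hlow (Pi.single i 1 - Pi.single k 1) fun l hl => by
      simp [Pi.single_eq_of_ne (ne_of_mem_of_not_mem hl (mem_compl.1 hi)),
        Pi.single_eq_of_ne (ne_of_mem_of_not_mem hl (mem_compl.1 hk))]
    have e1 : ∑ l, (Pi.single i 1 - Pi.single k 1 : Fin r → ℝ) l ^ 2 = 2 := by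
      have : ∀ l, (Pi.single i 1 - Pi.single k 1 : Fin r → ℝ) l ^ 2
          = (if l = i then 1 else 0) + (if l = k then 1 else 0) := by
        intro l
        by_cases h1 : l = i
        · subst h1; simp [hik]
        · by_cases h2 : l = k
          · subst h2; simp [h1]
          · simp [h1, h2]
      simp only [this, sum_add_distrib, sum_ite_eq', mem_univ, if_true]
      norm_num
    have e2 : ∑ l, (Pi.single i 1 - Pi.single k 1 : Fin r → ℝ) l • w l = w i - w k := by
      simp [sub_smul, Pi.single_apply, ite_smul, sum_sub_distrib]
    rw [e1, e2, map_sub] at this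
    linarith
  have hS : (Tᶜ : Finset (Fin r)).Nonempty := by
    rw [← card_pos, card_compl, Fintype.card_fin]
    omega
  choose s hs using hX.exists_near
  have hPX : ∑ i, h j i • P (w i) + P (X j - ∑ i, h j i • w i) = P (X j) := by
    simp [map_sub, map_sum]
  have hPs : ∀ i, P (w i) + P (X (s i) - w i) = P (X (s i)) := fun i => by simp [map_sub]
  obtain ⟨i, hi, hδi⟩ := hf.exists_one_sub_coeff_le hc.L_pos (y := fun i => P (w i)) hS
    (fun i => (hP.norm_map_le _).trans (hK i)) (half_pos hσ) hnorm hdist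
    (fun i hi => hP.norm_map_le_of_mem (by simpa using hi)) hc.L_mul_le hc.mul_le_K hc.mul_eq
    hc.δ_le (hX.coeff_nonneg j) (hX.sum_coeff_le j)
    ((hP.norm_map_le _).trans (hX.norm_sub_le j)) (e' := fun i => P (X (s i) - w i))
    (fun i => (hP.norm_map_le _).trans (hs i)) (fun i _ => by rw [hPX, hPs]; exact hj _)
  refine ⟨fun h0 => ?_, i, mem_compl.1 hi, ?_⟩
  · -- Otherwise `f` would vanish at the residual of a noisy copy of the unmatched vertex `w i`.
    have h1 := hj (s i)
    rw [h0, hf.map_zero] at h1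
    have h2 := (hf.le_map (P (X (s i)))).trans h1
    have h3 : ‖P (X (s i))‖ ^ 2 ≤ 0 := by
      by_contra! hpos
      have := mul_pos (half_pos hf.mu_pos) hpos
      linarith
    have h4 : P (X (s i)) = 0 := by
      simpa using le_antisymm h3 (sq_nonneg _)
    have h5 : P (w i) = -P (X (s i) - w i) := by
      rw [map_sub, h4]; simp
    have h6 := hnorm i hi
    rw [h5, norm_neg] at h6
    linarith [(hP.norm_map_le (X (s i) - w i)).trans (hs i), hc.lt_half]
  · have h1 := norm_sum_smul_sub_le (hX.coeff_nonneg j) (hX.sum_coeff_le j) hK i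
    have hK0 : 0 ≤ K := (norm_nonneg _).trans (hK i)
    have h2 : 2 * (1 - h j i) * K ≤ 2 * δ * K :=
      mul_le_mul_of_nonneg_right (by linarith) hK0
    have h3 := norm_add_le (X j - ∑ i, h j i • w i) (∑ i, h j i • w i - w i)
    rw [sub_add_sub_cancel] at h3
    linarith [hX.norm_sub_le j, hc.add_le]

/-- The invariant of the loop: when `T` is the set of matched vertices and `k` vertices are
left, the remaining run extracts `k` distinct columns, which match the unmatched vertices. -/
lemma Runs.exists_matching (hf : IsAdmissible f μ L)
    (hc : IsNoiseBound r μ L σ K ε η δ) {M : Matrix (Fin m) κ ℝ}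
    (hX : IsNearSeparable (column M) w h ε)
    (hK : ∀ i, ‖w i‖ ≤ K) (hw : ∀ c : Fin r → ℝ, σ ^ 2 * ∑ i, c i ^ 2 ≤ ‖∑ i, c i • w i‖ ^ 2)
    {k : ℕ} {R : Matrix (Fin m) κ ℝ} {J : List κ} (hrun : Runs f M k R J)
    {T : Finset (Fin r)} (hT : k + #T = r) {b : Fin r → EuclideanSpace ℝ (Fin m)}
    {P : EuclideanSpace ℝ (Fin m) →ₗ[ℝ] EuclideanSpace ℝ (Fin m)}
    (hP : IsResidualMap w η T b P) (hR : ∀ j, column R j = P (column M j)) :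
    J.length = k ∧ J.Nodup ∧ (∀ j ∈ J, P (column M j) ≠ 0) ∧
      ∃ I : List (Fin r), I.Nodup ∧ (∀ i ∈ I, i ∉ T) ∧
        List.Forall₂ (fun j i => ‖column M j - w i‖ ≤ η) J I := by
  induction hrun generalizing T b P with
  | full R => exact ⟨rfl, List.nodup_nil, by simp, [], List.nodup_nil, by simp, .nil⟩
  | zero k =>
    rcases Nat.eq_zero_or_pos k with rfl | hk
    · exact ⟨rfl, List.nodup_nil, by simp, [], List.nodup_nil, by simp, .nil⟩
    -- The residual cannot vanish while a vertex is unmatched.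
    exfalso
    have hz : ∀ j, P (column M j) = 0 := fun j => by
      rw [← hR]; ext; simp [column]
    obtain ⟨j, -⟩ := hX.exists_near ⟨0, by omega⟩
    exact (hP.exists_near_of_isMax hf hc hX hK hw (by omega) (j := j)
      (fun k => by rw [hz, hz])).1 (hz j)
  | @step k R j J hR0 hj hJ ih =>
    obtain ⟨hne, i, hi, hji⟩ := hP.exists_near_of_isMax hf hc hX hK hw (by omega) (j := j)
      (fun k => by rw [← hR, ← hR]; exact hj.1 k)
    have hP' := hP.comp_insert hi hji (Q := (projMatrix (column R j)).toEuclideanLin)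
      (norm_toEuclideanLin_projMatrix_le _)
      (by rw [← hR]; exact toEuclideanLin_projMatrix_self _)
      (fun z => ⟨_, by rw [toEuclideanLin_projMatrix_apply, sub_sub_cancel, hR]⟩)
    obtain ⟨hlen, hnd, hne', I, hI, hIT, hm⟩ := ih (by rw [card_insert_of_notMem hi]; omega) hP'
      (fun l => by rw [column_mul, hR l, LinearMap.comp_apply])
    refine ⟨by simp [hlen], List.nodup_cons.2 ⟨fun hjJ => hne' j hjJ ?_, hnd⟩, ?_, i :: I,
      List.nodup_cons.2 ⟨fun hiI => hIT i hiI (mem_insert_self _ _), hI⟩, ?_, .cons hji hm⟩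
    · simpa using hP'.map_eq_zero i (mem_insert_self _ _)
    · intro l hl
      rcases List.mem_cons.1 hl with rfl | hl
      · exact hne
      · exact fun h0 => hne' l hl (by rw [LinearMap.comp_apply, h0, _root_.map_zero])
    · intro l hl
      rcases List.mem_cons.1 hl with rfl | hl
      · exact hi
      · exact fun hlT => hIT l hl (mem_insert_of_mem hlT)

/-! ### Constants -/

/-- The noise level of the theorem meets the requirements, with
`δ = 40 ε (K / σ²) (L / μ)`. -/
lemma isNoiseBound_of_lt (hr : 2 ≤ r) (hμ : 0 < μ) (hL : 0 < L) (hμL : μ ≤ 2 * L)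
    (hσ : 0 < σ) (hσK : σ ≤ K) (hε : 0 ≤ ε)
    (hlt : ε < σ * min (1 / (2 * √((r : ℝ) - 1))) (1 / 4 * √(μ / L))
      * (1 + 80 * (K ^ 2 / σ ^ 2) * (L / μ))⁻¹) :
    IsNoiseBound r μ L σ K ε (ε * (1 + 80 * (K ^ 2 / σ ^ 2) * (L / μ)))
      (40 * ε * (K / σ ^ 2) * (L / μ)) := by
  have hK : 0 < K := hσ.trans_le hσK
  set q := K ^ 2 / σ ^ 2 * (L / μ) with hq
  have hq1 : 1 / 2 ≤ q := by
    have h1 : 1 ≤ K ^ 2 / σ ^ 2 := by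
      rw [le_div_iff₀ (by positivity), one_mul]
      exact pow_le_pow_left₀ hσ.le hσK 2
    have h2 : 1 / 2 ≤ L / μ := by
      rw [le_div_iff₀ hμ]; linarith
    nlinarith
  have e : 1 + 80 * (K ^ 2 / σ ^ 2) * (L / μ) = 1 + 80 * q := by rw [hq]; ring
  rw [e] at hlt ⊢
  have hpos : 0 < 1 + 80 * q := by linarith
  rw [← div_eq_mul_inv, lt_div_iff₀ hpos] at hlt
  set η := ε * (1 + 80 * q) with hη
  have hη0 : 0 ≤ η := by positivity
  clear_value η
  have hr1 : (0 : ℝ) < (r : ℝ) - 1 := by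
    have : (2 : ℝ) ≤ r := by exact_mod_cast hr
    linarith
  have hs : 0 < √((r : ℝ) - 1) := Real.sqrt_pos.2 hr1
  have hb1 : η ≤ σ * (1 / (2 * √((r : ℝ) - 1))) :=
    hlt.le.trans (mul_le_mul_of_nonneg_left (min_le_left _ _) hσ.le)
  have hb2 : η ≤ σ * (1 / 4 * √(μ / L)) :=
    hlt.le.trans (mul_le_mul_of_nonneg_left (min_le_right _ _) hσ.le)
  -- Only `μ ≤ 2 * L` is available here, so the second bound is at most `3 / 8 * σ`.
  have hb3 : √(μ / L) ≤ 3 / 2 := by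
    rw [Real.sqrt_le_left (by norm_num), div_le_iff₀ hL]
    linarith
  have hb4 : η ≤ 3 / 8 * σ := by nlinarith
  have hε41 : ε * 41 ≤ η := by
    rw [hη]
    exact mul_le_mul_of_nonneg_left (by linarith) hε
  have hδK : 40 * ε * (K / σ ^ 2) * (L / μ) * K = 40 * ε * q := by
    rw [hq]; ring
  refine ⟨hσ, hL, by linarith, by linarith, ?_, ?_, ?_, ?_, ?_⟩
  · have h1 := pow_le_pow_left₀ hη0 hb2 2
    rw [mul_pow, mul_pow, Real.sq_sqrt (by positivity)] at h1
    calc 4 * (L * η ^ 2) ≤ 4 * (L * (σ ^ 2 * ((1 / 4) ^ 2 * (μ / L)))) := by gcongr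
      _ = μ * (σ / 2) ^ 2 := by field_simp; norm_num
  · have h1 := pow_le_pow_left₀ hη0 hb1 2
    have h2 : (σ * (1 / (2 * √((r : ℝ) - 1)))) ^ 2 = (σ / 2) ^ 2 / ((r : ℝ) - 1) := by
      rw [mul_pow, div_pow, mul_pow, Real.sq_sqrt hr1.le]
      field_simp
    rw [h2, le_div_iff₀ hr1] at h1
    linarith
  · field_simp
    ring
  · refine le_of_mul_le_mul_right ?_ hK
    rw [hδK]
    have : η = ε + 80 * ε * q := by rw [hη]; ring
    linarith
  · have : η = ε + 80 * ε * q := by rw [hη]; ring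
    linarith [hδK]

end RecursiveNMF

theorem theorem3 {m r q : ℕ} (hr : 2 ≤ r)
    (W : Matrix (Fin m) (Fin r) ℝ) (hW : W.rank = r)
    (H' : Matrix (Fin r) (Fin q) ℝ) (hH' : ∀ j, H'.col j ∈ RecursiveNMF.unitSimplex r)
    (N : Matrix (Fin m) (Fin r ⊕ Fin q) ℝ)
    (f : EuclideanSpace ℝ (Fin m) → ℝ) (μ L : ℝ) (hf : RecursiveNMF.IsAdmissible f μ L)
    (ε : ℝ) (hN : ∀ j, ‖RecursiveNMF.column N j‖ ≤ ε)
    (hε : ε < RecursiveNMF.sigmaMin W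
        * min (1 / (2 * Real.sqrt ((r : ℝ) - 1))) (1 / 4 * Real.sqrt (μ / L))
        * (1 + 80 * (RecursiveNMF.maxColNorm W ^ 2 / RecursiveNMF.sigmaMin W ^ 2) * (L / μ))⁻¹)
    (M' : Matrix (Fin m) (Fin r ⊕ Fin q) ℝ)
    (hM' : M' = W * Matrix.fromCols (1 : Matrix (Fin r) (Fin r) ℝ) H' + N)
    (J : List (Fin r ⊕ Fin q)) (hJ : RecursiveNMF.IsOutput f M' r J) :
    J.Nodup ∧ ∃ hlen : J.length = r, ∃ P : Equiv.Perm (Fin r), ∀ k : Fin r,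
      ‖RecursiveNMF.column M' (J.get (Fin.cast hlen.symm k)) - RecursiveNMF.column W (P k)‖
        ≤ ε * (1 + 80 * (RecursiveNMF.maxColNorm W ^ 2 / RecursiveNMF.sigmaMin W ^ 2) * (L / μ)) := by
  open RecursiveNMF in
  have hε0 : 0 ≤ ε := (norm_nonneg _).trans (hN (Sum.inl ⟨0, by omega⟩))
  have hw := sq_sigmaMin_mul_le W
  have hK := norm_column_le_maxColNorm W
  have hσ : 0 < sigmaMin W := by
    -- If it vanished, the bound on `ε` would read `ε < 0`.
    refine lt_of_le_of_ne (LinearMap.singularValues_nonneg _ _) fun h0 => ?_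
    rw [← h0] at hε
    simp only [zero_mul] at hε
    linarith
  have hσw : ∀ i, sigmaMin W ≤ ‖column W i‖ := by
    intro i
    have := hw (Pi.single i 1)
    simp only [Pi.single_apply, ite_pow, one_pow, ne_eq, OfNat.ofNat_ne_zero, not_false_eq_true,
      zero_pow, Finset.sum_ite_eq', Finset.mem_univ, if_true, mul_one, ite_smul, one_smul,
      zero_smul] at this
    exact le_of_sq_le_sq this (norm_nonneg _)
  have i0 : Fin r := ⟨0, by omega⟩
  obtain ⟨hL, hμL⟩ := hf.lipschitz_pos (norm_pos_iff.1 (hσ.trans_le (hσw i0)))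
  have hc := isNoiseBound_of_lt hr hf.mu_pos hL hμL hσ ((hσw i0).trans (hK i0)) hε0 hε
  set H : Matrix (Fin r) (Fin r ⊕ Fin q) ℝ := Matrix.fromCols 1 H' with hH
  have hcol : ∀ j, column M' j = ∑ i, H i j • column W i + column N j := by
    intro j
    ext k
    simp [hM', column, Matrix.mul_apply, mul_comm]
  have hinl : ∀ i, column M' (Sum.inl i) = column W i + column N (Sum.inl i) := by
    intro i
    rw [hcol]
    simp [hH, Matrix.one_apply, ite_smul]
  have hX : IsNearSeparable (column M') (column W) (fun j i => H i j) ε := by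
    refine ⟨?_, ?_, fun j => ?_, fun i => ⟨Sum.inl i, ?_⟩⟩
    · rintro (j | j) i
      · simp only [hH, Matrix.fromCols_apply_inl, Matrix.one_apply]
        split_ifs <;> norm_num
      · exact (hH' j).1 i
    · rintro (j | j)
      · simp [hH, Matrix.one_apply]
      · exact (hH' j).2
    · rw [hcol, add_sub_cancel_left]
      exact hN j
    · rw [hinl, add_sub_cancel_left]
      exact hN _
  obtain ⟨hlen, hnd, -, I, hI, -, hm⟩ := Runs.exists_matching hf hc hX hK hw hJ (T := ∅)
    (by simp) (isResidualMap_id _ 0 _) (fun _ => rfl)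
  have hIlen : I.length = r := hm.length_eq ▸ hlen
  refine ⟨hnd, hlen, Equiv.ofBijective (fun k => I.get (Fin.cast hIlen.symm k)) ?_, fun k => ?_⟩
  · refine Finite.injective_iff_bijective.1 fun a b hab => ?_
    simpa [Fin.ext_iff] using (List.nodup_iff_injective_get.1 hI) hab
  · exact (List.forall₂_iff_get.1 hm).2 k _ _
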